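/- Let $d$ be an odd positive integer and let $n\ge d+1$. Call a real $(d+1)\times n$ matrix positive if all its maximal minors (the determinants of $d+1$ columns taken in increasing order) are positive. Let $S_n$ act on real $(d+1)\times n$ matrices by permuting columns, and let $C^d_n\le S_n$ be the stabiliser of the set of positive matrices. Then: (i) If $n=d+1$, then $C^d_n=A_n$, the alternating group. (ii) If $n=d+2$, then $C^d_n=A_n\cap\bigl(S_{\frac{n-1}{2}}\times S_{\frac{n+1}{2}}\bigr)$, where $S_{\frac{n-1}{2}}\times S_{\frac{n+1}{2}}\le S_n$ is the subgroup whose first factor permutes the $\frac{n-1}{2}$ even elements of $\{1,\dots,n\}$ and whose second factor permutes the $\frac{n+1}{2}$ odd elements. (iii) If $n\ge d+3$ and $\frac{d+1}{2}$ is even, then $C^d_n\cong\mathbb Z/2$, generated by the order-reversing permutation $i\mapsto n+1-i$. (iv) If $n\ge d+3$ and $\frac{d+1}{2}$ is odd, then $C^d_n$ is trivial. -/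

import Mathlib

/-- A real `k × n` matrix is positive if all its maximal (that is, `k × k`) minors are positive:
for all column indices `f 0 < ⋯ < f (k - 1)`, the determinant of these columns is positive. -/
def IsPositiveMatrix {k n : ℕ} (X : Matrix (Fin k) (Fin n) ℝ) : Prop :=
  ∀ f : Fin k ↪o Fin n, 0 < (X.submatrix id f).det

/-- `σ` permutes the columns of `X`: column `i` of the result is column `σ i` of `X`. -/
def permuteColumns {k n : ℕ} (σ : Equiv.Perm (Fin n)) (X : Matrix (Fin k) (Fin n) ℝ) :
    Matrix (Fin k) (Fin n) ℝ :=
  X.submatrix id σ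

/-- The group `C^d_n`: the setwise stabiliser in `S_n` of the set of positive `(d + 1) × n`
matrices, under permutation of columns. -/
def positiveStabilizer (d n : ℕ) : Subgroup (Equiv.Perm (Fin n)) where
  carrier := {σ | ∀ X : Matrix (Fin (d + 1)) (Fin n) ℝ,
    IsPositiveMatrix (permuteColumns σ X) ↔ IsPositiveMatrix X}
  one_mem' := fun _ => Iff.rfl
  mul_mem' := fun {σ τ} hσ hτ X => (hτ (permuteColumns σ X)).trans (hσ X)
  inv_mem' := fun {σ} hσ X => by
    have h := hσ (permuteColumns σ⁻¹ X)
    have e : permuteColumns σ (permuteColumns σ⁻¹ X) = X := by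
      ext i j
      simp [permuteColumns]
    rw [e] at h
    exact h.symm

/-- The subgroup `S_a × S_b` of `S_n` given by a splitting of the `n` indices into a block of
size `a` and a block of size `b`: the permutations that act separately on the two blocks. -/
def blockSubgroup {a b n : ℕ} (e : Fin a ⊕ Fin b ≃ Fin n) : Subgroup (Equiv.Perm (Fin n)) :=
  (Equiv.Perm.sumCongrHom (Fin a) (Fin b)).range.map e.permCongrHom.toMonoidHom

/-!
Permuting columns by `σ` multiplies the minor on a set `S` of columns by the sign of the
rearrangement `σ` induces on `S`, that is, by the product over the pairs in `S` of `1` or `-1`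
according to whether `σ` keeps or inverts the order of the pair. Since positive matrices exist
(Vandermonde), `σ` lies in the stabiliser if and only if every `(d + 1)`-set `S` carries an even
number of inversions (`mem_positiveStabilizer_iff`). What remains is a statement about the graph
of inversions of `σ`.

As `d + 2` is odd, the handshake lemma shows that if all `(d + 1)`-subsets of a `(d + 2)`-set `T`
carry an even number of inversions, then so does `T` (`inversionSign_eq_one_of_odd`), and hence
every vertex of `T` has even degree in `T`. For `n = d + 2` the degree of `i` has the parity of
`i + σ i` (`prod_pairSign_univ`), which gives the even permutations preserving parity. For
`n ≥ d + 3`, comparing the `(d + 2)`-subsets of a `(d + 3)`-set shows that adjacency does not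
depend on the pair (`pairSign_eq_pairSign`), so `σ` inverts no pair or every pair: it is the
identity or the reversal. The latter is allowed when `(d + 1).choose 2` is even.
-/

open Finset

/-! ### Inversion signs -/

/-- The sign of the pair `i, j` under `σ`: it is `-1` if the pair is an inversion of `σ` and `1`
otherwise; in particular it is `1` for `i = j`. -/
def pairSign {n : ℕ} (σ : Equiv.Perm (Fin n)) (i j : Fin n) : ℤˣ :=
  if (i < j ↔ σ i < σ j) then 1 else -1

/-- The product of the pair signs over all pairs of elements of `S`, that is, the parity of the
number of inversions of `σ` inside `S`. -/
def inversionSign {n : ℕ} (σ : Equiv.Perm (Fin n)) (S : Finset (Fin n)) : ℤˣ :=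
  ∏ i ∈ S, ∏ j ∈ S, if i < j then pairSign σ i j else 1

section InversionSign

variable {n : ℕ} (σ : Equiv.Perm (Fin n))

theorem pairSign_self (i : Fin n) : pairSign σ i i = 1 := by
  simp [pairSign]

theorem pairSign_comm (i j : Fin n) : pairSign σ i j = pairSign σ j i := by
  rcases eq_or_ne i j with rfl | h
  · rfl
  · have h' : σ i ≠ σ j := σ.injective.ne h
    unfold pairSign
    congr 1
    apply propext
    rw [← h.le_iff_lt, ← h'.le_iff_lt, ← not_lt, ← not_lt, not_iff_not]

theorem inversionSign_insert {x : Fin n} {S : Finset (Fin n)} (hx : x ∉ S) :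
    inversionSign σ (insert x S) = inversionSign σ S * ∏ j ∈ S, pairSign σ x j := by
  unfold inversionSign
  rw [prod_insert hx, prod_insert hx, if_neg (lt_irrefl x), one_mul]
  simp only [prod_insert hx, prod_mul_distrib]
  rw [← mul_assoc, ← prod_mul_distrib, mul_comm]
  congr 1
  refine prod_congr rfl fun j hj => ?_
  have hne : x ≠ j := fun h => hx (h ▸ hj)
  rcases hne.lt_or_gt with h | h
  · simp [h, h.not_gt]
  · simp [h, h.not_gt, pairSign_comm σ j x]

theorem inversionSign_erase_mul {x : Fin n} {S : Finset (Fin n)} (hx : x ∈ S) :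
    inversionSign σ (S.erase x) * ∏ j ∈ S, pairSign σ x j = inversionSign σ S := by
  conv_rhs => rw [← insert_erase hx, inversionSign_insert σ (notMem_erase x S)]
  rw [← mul_prod_erase S _ hx, pairSign_self, one_mul]

/-- The handshake lemma: every pair is counted twice. -/
theorem prod_prod_pairSign (S : Finset (Fin n)) :
    ∏ i ∈ S, ∏ j ∈ S, pairSign σ i j = 1 := by
  rw [← prod_product']
  refine prod_involution (fun p _ => p.swap) ?_ ?_ ?_ ?_
  · intro p _
    simp only [Prod.fst_swap, Prod.snd_swap]
    rw [pairSign_comm σ p.2 p.1, Int.units_mul_self]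
  · rintro ⟨i, j⟩ _ h he
    have hij : j = i := congrArg Prod.fst he
    subst hij
    exact h (pairSign_self σ j)
  · intro p hp
    simpa [and_comm] using hp
  · intro p _
    exact Prod.swap_swap p

/-- If erasing any element of a set of odd size leaves an even number of inversions, then all
degrees in the inversion graph of the set have the parity of its number of edges, and the
handshake lemma forces this parity to be even. -/
theorem inversionSign_eq_one_of_odd {T : Finset (Fin n)} (hT : Odd #T)
    (h : ∀ i ∈ T, inversionSign σ (T.erase i) = 1) : inversionSign σ T = 1 := by
  have hdeg : ∀ i ∈ T, ∏ j ∈ T, pairSign σ i j = inversionSign σ T := fun i hi => by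
    rw [← inversionSign_erase_mul σ hi, h i hi, one_mul]
  have := prod_prod_pairSign σ T
  rw [prod_congr rfl hdeg, prod_const] at this
  obtain ⟨m, hm⟩ := hT
  rwa [hm, pow_succ, pow_mul, Int.units_sq, one_pow, one_mul] at this

theorem prod_ite_lt (i : Fin n) :
    ∏ j : Fin n, (if j < i then (-1 : ℤˣ) else 1) = (-1) ^ (i : ℕ) := by
  rw [← prod_filter, prod_const, filter_gt_eq_Iio, Fin.card_Iio]

/-- The number of inversions of `σ` that involve `i` has the parity of `i + σ i`. -/
theorem prod_pairSign_univ (i : Fin n) :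
    ∏ j, pairSign σ i j = (-1) ^ ((i : ℕ) + (σ i : ℕ)) := by
  rw [pow_add, ← prod_ite_lt i, ← prod_ite_lt (σ i),
    ← Equiv.prod_comp σ (fun j => if j < σ i then (-1 : ℤˣ) else 1), ← prod_mul_distrib]
  -- A pair is an inversion if and only if `j < i` and `σ j < σ i` are not equivalent.
  refine prod_congr rfl fun j _ => ?_
  rcases eq_or_ne i j with rfl | h
  · simp [pairSign]
  · have h' : σ i ≠ σ j := σ.injective.ne h
    rcases h.lt_or_gt with h1 | h1 <;> rcases h'.lt_or_gt with h2 | h2 <;>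
      simp [pairSign, h1, h2, h1.not_gt, h2.not_gt]

theorem inversionSign_eq_pow_choose {S : Finset (Fin n)}
    (h : ∀ i j, i ≠ j → pairSign σ i j = -1) : inversionSign σ S = (-1) ^ (#S).choose 2 := by
  induction S using Finset.induction_on with
  | empty => simp [inversionSign]
  | insert x S hx ih =>
    rw [inversionSign_insert σ hx, ih, card_insert_of_notMem hx,
      prod_congr rfl fun j hj => h x j fun e => hx (e ▸ hj), prod_const, Nat.choose_succ_succ' _ 1,
      Nat.choose_one_right, pow_add, mul_comm]

theorem inversionSign_univ : inversionSign σ univ = Equiv.Perm.sign σ := by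
  rw [Equiv.Perm.sign_eq_prod_prod_Ioi]
  unfold inversionSign
  refine prod_congr rfl fun i _ => ?_
  rw [← prod_filter, filter_lt_eq_Ioi]
  refine prod_congr rfl fun j hj => ?_
  simp [pairSign, mem_Ioi.1 hj]

end InversionSign

/-! ### Minors of a matrix with permuted columns -/

section Minors

variable {k n : ℕ}

/-- Writing `σ ∘ f = g ∘ τ` with `g` increasing, the sign of `τ` is the inversion sign of `σ` on
the range of `f`. -/
theorem det_permuteColumns_submatrix (σ : Equiv.Perm (Fin n)) (X : Matrix (Fin k) (Fin n) ℝ)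
    (f g : Fin k ↪o Fin n) (hfg : ∀ i, ∃ j, g j = σ (f i)) :
    ((permuteColumns σ X).submatrix id f).det =
      ((inversionSign σ (univ.map f.toEmbedding) : ℤˣ) : ℤ) * (X.submatrix id g).det := by
  choose t ht using hfg
  have hinj : Function.Injective t := fun a b hab => by
    have := ht a
    rw [hab, ht b] at this
    exact (f.injective (σ.injective this)).symm
  let τ : Equiv.Perm (Fin k) := Equiv.ofBijective t (Finite.injective_iff_bijective.1 hinj)
  have hτ : ∀ i, g (τ i) = σ (f i) := ht
  have hsign : inversionSign σ (univ.map f.toEmbedding) = Equiv.Perm.sign τ := by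
    rw [← inversionSign_univ]
    simp only [inversionSign, prod_map, RelEmbedding.coe_toEmbedding, pairSign, ← hτ,
      OrderEmbedding.lt_iff_lt]
  have hmat : (permuteColumns σ X).submatrix id f = (X.submatrix id g).submatrix id τ := by
    ext a b
    simp [permuteColumns, hτ]
  rw [hmat, Matrix.det_permute', hsign]

theorem exists_orderEmbedding_range {S : Finset (Fin n)} (hS : #S = k) :
    ∃ f : Fin k ↪o Fin n, univ.map f.toEmbedding = S :=
  ⟨S.orderEmbOfFin hS, S.map_orderEmbOfFin_univ hS⟩

/-- The columns `1, x, x ^ 2, …` for `x = 0, …, n - 1` form a positive matrix. -/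
theorem exists_isPositiveMatrix (k n : ℕ) :
    ∃ X : Matrix (Fin k) (Fin n) ℝ, IsPositiveMatrix X := by
  refine ⟨fun i j => ((j : ℕ) : ℝ) ^ (i : ℕ), fun f => ?_⟩
  have : (Matrix.submatrix (fun (i : Fin k) (j : Fin n) => ((j : ℕ) : ℝ) ^ (i : ℕ)) id f) =
      (Matrix.vandermonde fun a : Fin k => ((f a : ℕ) : ℝ)).transpose := by
    ext i j
    rfl
  rw [this, Matrix.det_transpose, Matrix.det_vandermonde]
  refine prod_pos fun i _ => prod_pos fun j hj => ?_
  have : (f i : ℕ) < f j := f.strictMono (mem_Ioi.1 hj)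
  simpa using this

theorem mem_positiveStabilizer_iff {d n : ℕ} (σ : Equiv.Perm (Fin n)) :
    σ ∈ positiveStabilizer d n ↔
      ∀ S : Finset (Fin n), #S = d + 1 → inversionSign σ S = 1 := by
  constructor
  · intro h S hS
    obtain ⟨X, hX⟩ := exists_isPositiveMatrix (d + 1) n
    obtain ⟨f, rfl⟩ := exists_orderEmbedding_range hS
    obtain ⟨g, hg⟩ := exists_orderEmbedding_range
      (S := (univ.map f.toEmbedding).map σ.toEmbedding) (by rw [card_map, hS])
    have hdet := det_permuteColumns_submatrix σ X f g fun i => by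
      have : σ (f i) ∈ univ.map g.toEmbedding := by rw [hg]; simp
      simpa using this
    have hpos := (h X).2 hX f
    rcases Int.units_eq_one_or (inversionSign σ (univ.map f.toEmbedding)) with h1 | h1
    · exact h1
    · rw [hdet, h1] at hpos
      have := hX g
      simp only [Units.val_neg, Units.val_one, Int.cast_neg, Int.cast_one, neg_mul, one_mul] at hpos
      linarith
  · intro h X
    constructor
    · intro hX g
      obtain ⟨f, hf⟩ := exists_orderEmbedding_range (k := d + 1)
        (S := (univ.map g.toEmbedding).map σ.symm.toEmbedding) (by simp)
      have hdet := det_permuteColumns_submatrix σ X f g fun i => by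
        have : f i ∈ (univ.map g.toEmbedding).map σ.symm.toEmbedding := by rw [← hf]; simp
        simpa [Equiv.symm_apply_eq] using this
      rw [h _ (by simp), Units.val_one, Int.cast_one, one_mul] at hdet
      exact hdet ▸ hX f
    · intro hX f
      obtain ⟨g, hg⟩ := exists_orderEmbedding_range (k := d + 1)
        (S := (univ.map f.toEmbedding).map σ.toEmbedding) (by simp)
      rw [det_permuteColumns_submatrix σ X f g fun i => by
        have : σ (f i) ∈ univ.map g.toEmbedding := by rw [hg]; simp
        simpa using this, h _ (by simp), Units.val_one, Int.cast_one, one_mul]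
      exact hX g

end Minors

/-! ### Matrices with one column more than rows -/

/-- The splitting of the indices into the positions `2, 4, …` and the positions `1, 3, …`, counted
from `1`. -/
theorem exists_parityEquiv {n : ℕ} (hn : Odd n) :
    ∃ e : Fin ((n - 1) / 2) ⊕ Fin ((n + 1) / 2) ≃ Fin n,
      (∀ k, (e (Sum.inl k) : ℕ) + 1 = 2 * ((k : ℕ) + 1)) ∧
      (∀ k, (e (Sum.inr k) : ℕ) + 1 = 2 * (k : ℕ) + 1) := by
  obtain ⟨m, hm⟩ := hn
  let φ : Fin ((n - 1) / 2) ⊕ Fin ((n + 1) / 2) → Fin n :=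
    Sum.elim (fun k => ⟨2 * k + 1, by omega⟩) (fun k => ⟨2 * k, by omega⟩)
  have hinj : Function.Injective φ := by
    rintro (a | a) (b | b) hab <;> simp only [φ, Sum.elim_inl, Sum.elim_inr, Fin.mk.injEq] at hab
    · exact congrArg Sum.inl (Fin.ext (by omega))
    · omega
    · omega
    · exact congrArg Sum.inr (Fin.ext (by omega))
  refine ⟨Equiv.ofBijective φ ((Fintype.bijective_iff_injective_and_card φ).2 ⟨hinj, ?_⟩),
    fun k => ?_, fun k => ?_⟩
  · simp only [Fintype.card_sum, Fintype.card_fin]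
    omega
  · simp [φ]
    ring
  · simp [φ]

theorem mem_blockSubgroup_iff {a b n : ℕ} (e : Fin a ⊕ Fin b ≃ Fin n)
    (hl : ∀ k, (e (Sum.inl k) : ℕ) + 1 = 2 * ((k : ℕ) + 1))
    (hr : ∀ k, (e (Sum.inr k) : ℕ) + 1 = 2 * (k : ℕ) + 1) (σ : Equiv.Perm (Fin n)) :
    σ ∈ blockSubgroup e ↔ ∀ i : Fin n, Even ((i : ℕ) + (σ i : ℕ)) := by
  constructor
  · rintro ⟨_, ⟨⟨α, β⟩, rfl⟩, rfl⟩ i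
    obtain ⟨x, rfl⟩ := e.surjective i
    rcases x with k | k
    · have h1 := hl k
      have h2 := hl (α k)
      have h3 : e.permCongrHom.toMonoidHom (Equiv.Perm.sumCongrHom _ _ (α, β)) (e (Sum.inl k)) =
          e (Sum.inl (α k)) := by
        simp [Equiv.permCongrHom, Equiv.permCongr_apply]
      rw [h3, Nat.even_iff]
      omega
    · have h1 := hr k
      have h2 := hr (β k)
      have h3 : e.permCongrHom.toMonoidHom (Equiv.Perm.sumCongrHom _ _ (α, β)) (e (Sum.inr k)) =
          e (Sum.inr (β k)) := by
        simp [Equiv.permCongrHom, Equiv.permCongr_apply]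
      rw [h3, Nat.even_iff]
      omega
  · intro h
    refine ⟨e.symm.permCongr σ, ?_, ?_⟩
    · refine Equiv.Perm.mem_sumCongrHom_range_of_perm_mapsTo_inl ?_
      rintro _ ⟨k, rfl⟩
      rcases hy : e.symm.permCongr σ (Sum.inl k) with y | y
      · exact ⟨y, rfl⟩
      · have h1 := hl k
        have h2 := hr y
        have h3 := h (e (Sum.inl k))
        have h4 : σ (e (Sum.inl k)) = e (Sum.inr y) := by
          rw [← hy]
          simp [Equiv.permCongr_apply]
        rw [h4, Nat.even_iff] at h3
        omega
    · ext i
      simp [Equiv.permCongrHom, Equiv.permCongr_apply]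

theorem mem_positiveStabilizer_add_two_iff {d : ℕ} (hd : Odd d) (σ : Equiv.Perm (Fin (d + 2))) :
    σ ∈ positiveStabilizer d (d + 2) ↔
      Equiv.Perm.sign σ = 1 ∧ ∀ i : Fin (d + 2), Even ((i : ℕ) + (σ i : ℕ)) := by
  have hpow : ∀ m : ℕ, (-1 : ℤˣ) ^ m = 1 ↔ Even m := fun m =>
    neg_one_pow_eq_one_iff_even (by decide)
  have hdeg : ∀ i : Fin (d + 2), inversionSign σ (univ.erase i) * (-1) ^ ((i : ℕ) + (σ i : ℕ)) =
      Equiv.Perm.sign σ := fun i => by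
    rw [← prod_pairSign_univ, inversionSign_erase_mul σ (mem_univ i), inversionSign_univ]
  rw [mem_positiveStabilizer_iff]
  constructor
  · intro h
    have h1 : ∀ i, inversionSign σ (univ.erase i) = 1 := fun i =>
      h _ (by rw [card_erase_of_mem (mem_univ i), card_univ, Fintype.card_fin]; rfl)
    have hs : Equiv.Perm.sign σ = 1 := by
      rw [← inversionSign_univ]
      refine inversionSign_eq_one_of_odd σ ?_ fun i _ => h1 i
      rw [card_univ, Fintype.card_fin]
      exact hd.add_even even_two
    refine ⟨hs, fun i => (hpow _).1 ?_⟩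
    have := hdeg i
    rwa [h1 i, one_mul, hs] at this
  · rintro ⟨hs, hp⟩ S hS
    obtain ⟨i, hi⟩ : ∃ i, Sᶜ = {i} := card_eq_one.1 (by
      rw [card_compl, Fintype.card_fin, hS]
      omega)
    have hS' : S = univ.erase i := by
      rw [← compl_compl S, hi, compl_singleton]
    have := hdeg i
    rwa [(hpow _).2 (hp i), mul_one, hs, ← hS'] at this

/-! ### Matrices with at least two columns more than rows -/

section Large

variable {d n : ℕ}

theorem pairSign_eq_of_mem_positiveStabilizer (hd : Odd d) (hn : d + 3 ≤ n)
    {σ : Equiv.Perm (Fin n)} (hσ : σ ∈ positiveStabilizer d n) {i j l : Fin n} (hj : i ≠ j)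
    (hl : i ≠ l) : pairSign σ i j = pairSign σ i l := by
  rw [mem_positiveStabilizer_iff] at hσ
  obtain ⟨U, hU, hUc⟩ := exists_superset_card_eq (s := ({i, j, l} : Finset (Fin n))) (n := d + 3)
    (card_le_three.trans (by omega)) (by rwa [Fintype.card_fin])
  have hiU : i ∈ U := hU (by simp)
  -- Each pair sign at `i` is the parity of the degree of `i` in `U`, as the degree of `i` in the
  -- `(d + 2)`-set left by erasing the other vertex is even.
  have key : ∀ x ∈ U, i ≠ x → pairSign σ i x = ∏ y ∈ U, pairSign σ i y := by
    intro x hx hix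
    have hT : #(U.erase x) = d + 2 := by rw [card_erase_of_mem hx, hUc]; rfl
    have h1 : ∀ y ∈ U.erase x, inversionSign σ ((U.erase x).erase y) = 1 := fun y hy =>
      hσ _ (by rw [card_erase_of_mem hy, hT]; rfl)
    have h2 : inversionSign σ (U.erase x) = 1 :=
      inversionSign_eq_one_of_odd σ (hT ▸ hd.add_even even_two) h1
    have hi : i ∈ U.erase x := mem_erase.2 ⟨hix, hiU⟩
    have h3 := inversionSign_erase_mul σ hi
    rw [h1 i hi, h2, one_mul] at h3
    rw [← mul_prod_erase U _ hx, h3, mul_one]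
  rw [key j (hU (by simp)) hj, key l (hU (by simp)) hl]

theorem pairSign_eq_pairSign (hd : Odd d) (hn : d + 3 ≤ n) {σ : Equiv.Perm (Fin n)}
    (hσ : σ ∈ positiveStabilizer d n) {i j i' j' : Fin n} (h : i ≠ j) (h' : i' ≠ j') :
    pairSign σ i j = pairSign σ i' j' := by
  rcases eq_or_ne i i' with rfl | hi
  · exact pairSign_eq_of_mem_positiveStabilizer hd hn hσ h h'
  · rw [pairSign_eq_of_mem_positiveStabilizer hd hn hσ h hi, pairSign_comm,
      pairSign_eq_of_mem_positiveStabilizer hd hn hσ hi.symm h']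

theorem eq_one_of_pairSign_eq_one {σ : Equiv.Perm (Fin n)}
    (h : ∀ i j, i ≠ j → pairSign σ i j = 1) : σ = 1 := by
  have hm : StrictMono σ := fun i j hij => by
    have := h i j hij.ne
    unfold pairSign at this
    split_ifs at this with hc
    · exact hc.1 hij
    · exact absurd this (by decide)
  ext i
  exact congrArg Fin.val (congrFun ((hm.range_inj strictMono_id).1
    (by rw [σ.surjective.range_eq, Set.range_id])) i)

theorem pairSign_revPerm {i j : Fin n} (h : i ≠ j) : pairSign Fin.revPerm i j = -1 := by
  rcases h.lt_or_gt with h | h <;> simp [pairSign, h, h.not_gt]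

theorem eq_revPerm_of_pairSign_eq_neg_one {σ : Equiv.Perm (Fin n)}
    (h : ∀ i j, i ≠ j → pairSign σ i j = -1) : σ = Fin.revPerm := by
  have hm : StrictMono (Fin.rev ∘ σ) := fun i j hij => by
    have := h i j hij.ne
    have hc : ¬ (i < j ↔ σ i < σ j) := fun hc => by
      rw [pairSign, if_pos hc] at this
      exact absurd this (by decide)
    have h1 : ¬ σ i < σ j := fun h2 => hc ⟨fun _ => h2, fun _ => hij⟩
    exact Fin.rev_lt_rev.2 (lt_of_le_of_ne (not_lt.1 h1) (σ.injective.ne hij.ne'))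
  have hid := (hm.range_inj strictMono_id).1 (by
    rw [(Fin.rev_surjective.comp σ.surjective).range_eq, Set.range_id])
  refine Equiv.ext fun i => ?_
  have : Fin.rev (σ i) = i := congrFun hid i
  rw [Fin.revPerm_apply, ← this, Fin.rev_rev, this]

theorem eq_one_or_eq_revPerm (hd : Odd d) (hn : d + 3 ≤ n) {σ : Equiv.Perm (Fin n)}
    (hσ : σ ∈ positiveStabilizer d n) : σ = 1 ∨ σ = Fin.revPerm := by
  have h01 : (⟨0, by omega⟩ : Fin n) ≠ ⟨1, by omega⟩ := by simp
  rcases Int.units_eq_one_or (pairSign σ ⟨0, by omega⟩ ⟨1, by omega⟩) with h | h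
  · exact Or.inl (eq_one_of_pairSign_eq_one fun i j hij =>
      (pairSign_eq_pairSign hd hn hσ hij h01).trans h)
  · exact Or.inr (eq_revPerm_of_pairSign_eq_neg_one fun i j hij =>
      (pairSign_eq_pairSign hd hn hσ hij h01).trans h)

theorem revPerm_mem_positiveStabilizer_iff (hd : Odd d) (hn : d + 1 ≤ n) :
    (Fin.revPerm : Equiv.Perm (Fin n)) ∈ positiveStabilizer d n ↔ Even ((d + 1) / 2) := by
  have hchoose : Even ((d + 1).choose 2) ↔ Even ((d + 1) / 2) := by
    obtain ⟨m, rfl⟩ := hd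
    have h1 : (2 * m + 1 + 1) / 2 = m + 1 := by omega
    have h2 : (2 * m + 1 + 1).choose 2 = (m + 1) * (2 * m + 1) := by
      rw [Nat.choose_two_right]
      refine Nat.div_eq_of_eq_mul_left two_pos ?_
      rw [Nat.add_sub_cancel]
      ring
    rw [h1, h2, Nat.even_mul]
    simp
  have hinv : ∀ S : Finset (Fin n), #S = d + 1 →
      (inversionSign Fin.revPerm S = 1 ↔ Even ((d + 1) / 2)) := fun S hS => by
    rw [inversionSign_eq_pow_choose _ fun i j => pairSign_revPerm, hS,
      neg_one_pow_eq_one_iff_even (by decide), hchoose]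
  rw [mem_positiveStabilizer_iff]
  constructor
  · intro h
    obtain ⟨S, -, hS⟩ := exists_subset_card_eq (s := (univ : Finset (Fin n))) (n := d + 1)
      (by rwa [card_univ, Fintype.card_fin])
    exact (hinv S hS).1 (h S hS)
  · exact fun h S hS => (hinv S hS).2 h

theorem orderOf_revPerm (hn : 2 ≤ n) : orderOf (Fin.revPerm : Equiv.Perm (Fin n)) = 2 := by
  refine orderOf_eq_prime (Equiv.ext fun i => by simp [pow_two]) fun h => ?_
  have := congrArg Fin.val (Equiv.congr_fun h (⟨0, by omega⟩ : Fin n))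
  simp [Fin.val_rev] at this
  omega

end Large

/-! ### The stabiliser -/

theorem mainTheorem2 (d n : ℕ) (hd : Odd d) :
    (n = d + 1 → positiveStabilizer d n = alternatingGroup (Fin n)) ∧
    -- The first block consists of the even positions and the second one of the odd positions,
    -- counted from 1; the index `i : Fin n` stands for the position `i + 1`.
    (n = d + 2 →
      ∃ e : Fin ((n - 1) / 2) ⊕ Fin ((n + 1) / 2) ≃ Fin n,
        (∀ k, (e (Sum.inl k) : ℕ) + 1 = 2 * ((k : ℕ) + 1)) ∧
        (∀ k, (e (Sum.inr k) : ℕ) + 1 = 2 * (k : ℕ) + 1) ∧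
        positiveStabilizer d n = alternatingGroup (Fin n) ⊓ blockSubgroup e) ∧
    (d + 3 ≤ n → Even ((d + 1) / 2) →
      positiveStabilizer d n = Subgroup.zpowers (Fin.revPerm : Equiv.Perm (Fin n)) ∧
      Nonempty (positiveStabilizer d n ≃* Multiplicative (ZMod 2))) ∧
    (d + 3 ≤ n → Odd ((d + 1) / 2) → positiveStabilizer d n = ⊥) := by
  refine ⟨?_, ?_, ?_, ?_⟩
  · rintro rfl
    ext σ
    rw [mem_positiveStabilizer_iff, Equiv.Perm.mem_alternatingGroup, ← inversionSign_univ]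
    refine ⟨fun h => h _ (by simp), fun h S hS => ?_⟩
    rwa [(card_eq_iff_eq_univ S).1 (by rw [hS, Fintype.card_fin])]
  · rintro rfl
    obtain ⟨e, hl, hr⟩ := exists_parityEquiv (hd.add_even even_two)
    refine ⟨e, hl, hr, ?_⟩
    ext σ
    rw [mem_positiveStabilizer_add_two_iff hd, Subgroup.mem_inf,
      Equiv.Perm.mem_alternatingGroup, mem_blockSubgroup_iff e hl hr]
  · intro hn heven
    have hz : positiveStabilizer d n = Subgroup.zpowers (Fin.revPerm : Equiv.Perm (Fin n)) := by
      refine le_antisymm (fun σ hσ => ?_) (Subgroup.zpowers_le.2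
        ((revPerm_mem_positiveStabilizer_iff hd (by omega)).2 heven))
      rcases eq_one_or_eq_revPerm hd hn hσ with rfl | rfl
      · exact one_mem _
      · exact Subgroup.mem_zpowers _
    refine ⟨hz, ?_⟩
    have hcard : Nat.card (Subgroup.zpowers (Fin.revPerm : Equiv.Perm (Fin n))) = 2 := by
      rw [Nat.card_zpowers, orderOf_revPerm (by omega)]
    rw [hz]
    exact ⟨mulEquivOfPrimeCardEq (p := 2) hcard (by simp)⟩
  · intro hn hodd
    refine (Subgroup.eq_bot_iff_forall _).2 fun σ hσ => ?_
    rcases eq_one_or_eq_revPerm hd hn hσ with h | rfl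
    · exact h
    · exact absurd ((revPerm_mem_positiveStabilizer_iff hd (by omega)).1 hσ)
        (Nat.not_even_iff_odd.2 hodd)
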